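/- For $|t|\le 2\pi/3$ let $A(t)=(\sin t,\,-\tfrac12-\cos t,\,0)$ and $B(t)=\bigl(0,\ \tfrac12-\tfrac{\cos t}{1+\cos t},\ \tfrac{\sqrt{1+2\cos t}}{1+\cos t}\bigr)$, and $\omega(m,t)=(1-m)A(t)+mB(t)$, $m\in\mathbb R$. The extended oloid $\mathcal O$ (the developable surface of the circles $x^2+(y+\frac12)^2=1,\ z=0$ and $(y-\frac12)^2+z^2=1,\ x=0$) is the union of the lines $(\omega_1,\omega_2,\pm\omega_3)(\cdot,t)$. For $t\in\mathbb R$ put $$k(t)=\operatorname{sgn}(t)\left\lfloor\frac{3|t|}{4\pi}+\frac12\right\rfloor,\qquad h(t)=t-k(t)\,\frac{4\pi}{3}\in\left[-\frac{2\pi}{3},\frac{2\pi}{3}\right],$$ and unroll $\mathcal O$ by $$X(t,m)=\bigl((-1)^{k(t)}\omega_1(m,h(t)),\ \omega_2(m,h(t)),\ -(-1)^{k(t)}\omega_3(m,h(t))\bigr),\qquad t,m\in\mathbb R,$$ which is continuous, and $8\pi/3$-periodic in $t$. A development of $\mathcal O$ onto its tangent plane $E$ along the line $t=0$ is a continuous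 map $D:\mathbb R^2\to E=\mathbb R^2$ that maps every generating line $X(t,\cdot)$ isometrically, is differentiable in $t$ with the same first fundamental form as $X$ where $|h(t)|<2\pi/3$, and is orientation-compatible, i.e. $\det(\partial_mD,\partial_tD)=\langle N(t),\partial_mX\times\partial_tX\rangle$ there for some continuous unit normal field $N$ of $\mathcal O$ along the generating lines. The Cartesian coordinates $(\xi,\eta)$ in $E$ are such that the line $t=0$ is the $\eta$-axis, with origin $m=0$ and directed to increasing $m$, and the $\xi$-axis is directed to increasing $t$ (the $\xi$-component of $\partial_tD(0,0)$ is positive). The edge of regression $\mathcal R$ of $\mathcal O$ consists of the points $X(t,m)$ at which the ruled parametrization is singular: the (right-hand) derivative $\partial_tX(t,m)$ exists and is parallel to the generating line. **Theorem.** There is exactly one development $D$ of $\mathcal O$ onto $E$. For every $t$ with $\cos h(t)\ne 0$ the generating line with parameter $t$ contains exactly one point of $\mathcal R$ in this sense, and $D$ maps it to $(g_1^*(t),g_2^*(t))$; for $\cos h(t)=0$ there is no such point. Hence the development of $\mathcal R$ onto $E$ is the curve $$\mathcal R^*=\{(g_1^*(t),g_2^*(t))\mid t\in\mathbb R,\ \cos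 h(t)\neq0\},$$ where $$g_1^*(t)=\operatorname{sgn}(t)\left\lfloor\frac{3|t|}{4\pi}+\frac12\right\rfloor\frac{4\pi}{3\sqrt3}+\operatorname{sgn}(h(t))\,\tilde g_1(h(t)),\qquad g_2^*(t)=\tilde g_2(h(t)),$$ and, with $c=\cos t$, $s=\sin t$, $$\tilde g_1(t)=\frac{2\sqrt3}{9}\left(\arccos\frac{\sqrt2\,c}{\sqrt{1+c}}-\frac{(2+2c-c^2)\sqrt{2(1+2c)}\,|s|}{3c(1+c)^{3/2}}\right),$$ $$\tilde g_2(t)=\frac{\sqrt3}{9}\left(\ln\frac{2}{1+c}+\frac{7+33c+18c^2-4c^3}{3c(1+c)}\right).$$ -/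

import Mathlib

open Real Set
open scoped RealInnerProductSpace

noncomputable section

namespace Oloid

/-- Euclidean three-space, the ambient space of the extended oloid. -/
abbrev Space := EuclideanSpace ℝ (Fin 3)

/-- The plane of development `E` in its Cartesian coordinates `(ξ, η)`. -/
abbrev Plane := EuclideanSpace ℝ (Fin 2)

/-- The point `A` of the circle `x² + (y + 1/2)² = 1`, `z = 0`. -/
def alpha (t : ℝ) : Space := !₂[sin t, -1 / 2 - cos t, 0]

/-- The point `B₁` of the circle `(y - 1/2)² + z² = 1`, `x = 0`, which is joined to `alpha t` by a
generating line, for `|t| ≤ 2π/3`. -/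
def beta (t : ℝ) : Space :=
  !₂[0, 1 / 2 - cos t / (1 + cos t), √(1 + 2 * cos t) / (1 + cos t)]

/-- For fixed `t` with `|t| ≤ 2π/3`, the parametrization of the generating line `A B₁`. The
generating lines of the extended oloid are these lines and their mirror images in `z = 0`. -/
def omega (m t : ℝ) : Space := (1 - m) • alpha t + m • beta t

/-- `sgn(t) ⌊3|t|/(4π) + 1/2⌋`, the number of the piece of the unrolled surface
(`[(4k - 2)π/3, (4k + 2)π/3]` is the `k`-th piece) in which `t` lies. -/
def pieceIndex (t : ℝ) : ℤ := (SignType.sign t : ℤ) * ⌊3 * |t| / (4 * π) + 1 / 2⌋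

/-- `h(t) = t - sgn(t) ⌊3|t|/(4π) + 1/2⌋ · 4π/3`, a number in `[-2π/3, 2π/3]`. -/
def h (t : ℝ) : ℝ := t - pieceIndex t * (4 * π / 3)

/-- The extended oloid, unrolled: for each real `t`, the map `m ↦ surface t m` parametrizes a
generating line. On the piece `k = 0` these are the lines `(ω₁, ω₂, -ω₃)(m, t)`. At `t = 2π/3` the
surface is continued on its other half by the lines `(ω₁, ω₂, ω₃)(m, 4π/3 - t)`, and so on; since
`ω₁` is odd and `ω₂`, `ω₃` are even in `t`, the sign `(-1)^k` accounts for this. As a function of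
`t` this has the period `8π/3`, and the foot `surface t 0` runs to and fro on an arc of the first
circle, with arc length `t`. -/
def surface (t m : ℝ) : Space :=
  !₂[(-1) ^ pieceIndex t * omega m (h t) 0,
     omega m (h t) 1,
     -((-1) ^ pieceIndex t * omega m (h t) 2)]

/-- Partial derivative with respect to the parameter `t` of the generating line. -/
def partialT {F : Type*} [NormedAddCommGroup F] [NormedSpace ℝ F] (S : ℝ → ℝ → F) (t m : ℝ) : F :=
  deriv (fun τ => S τ m) t

/-- Partial derivative with respect to the parameter `m` on the generating line. -/
def partialM {F : Type*} [NormedAddCommGroup F] [NormedSpace ℝ F] (S : ℝ → ℝ → F) (t m : ℝ) : F :=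
  deriv (fun μ => S t μ) m

/-- The oriented area of two vectors of the plane. -/
def area (u v : Plane) : ℝ := u 0 * v 1 - u 1 * v 0

/-- The oriented volume `⟨n, u × v⟩` of three vectors of space. -/
def volume3 (n u v : Space) : ℝ :=
  n 0 * (u 1 * v 2 - u 2 * v 1) + n 1 * (u 2 * v 0 - u 0 * v 2) + n 2 * (u 0 * v 1 - u 1 * v 0)

/-- A continuous unit normal field of the unrolled surface. It depends on the generating line only
(the tangent plane is constant along a generating line). The lines with `|h t| = 2π/3`, where two
pieces meet and `surface` is not differentiable in `t`, are reached by continuity. -/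
structure IsUnitNormal (N : ℝ → Space) : Prop where
  continuous : Continuous N
  norm_eq_one : ∀ t, ‖N t‖ = 1
  orthogonal : ∀ t, |h t| < 2 * π / 3 → ∀ m,
    ⟪N t, partialM surface t m⟫ = 0 ∧ ⟪N t, partialT surface t m⟫ = 0

/-- `D` is the development of the (unrolled) extended oloid onto its tangent plane `E` along the
generating line `t = 0`: a continuous map that is isometric on every generating line, has
the first fundamental form of the surface, and is compatible with an orientation of the surface
(so that the surface is nowhere turned over). The coordinates in `E` are those
for which the generating line `t = 0` is the `η`-axis with `m = 0` as origin, directed to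
increasing `m`, and the `ξ`-axis is directed to increasing `t`. -/
structure IsDevelopment (D : ℝ → ℝ → Plane) : Prop where
  continuous : Continuous (fun p : ℝ × ℝ => D p.1 p.2)
  isometric_on_lines : ∀ t m m', dist (D t m) (D t m') = dist (surface t m) (surface t m')
  differentiable : ∀ t, |h t| < 2 * π / 3 → ∀ m, DifferentiableAt ℝ (fun τ => D τ m) t
  first_form : ∀ t, |h t| < 2 * π / 3 → ∀ m,
    ⟪partialM D t m, partialM D t m⟫ = ⟪partialM surface t m, partialM surface t m⟫ ∧
    ⟪partialM D t m, partialT D t m⟫ = ⟪partialM surface t m, partialT surface t m⟫ ∧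
    ⟪partialT D t m, partialT D t m⟫ = ⟪partialT surface t m, partialT surface t m⟫
  oriented : ∃ N, IsUnitNormal N ∧ ∀ t, |h t| < 2 * π / 3 → ∀ m,
    area (partialM D t m) (partialT D t m) =
      volume3 (N t) (partialM surface t m) (partialT surface t m)
  eta_axis : ∀ m, D 0 m = !₂[0, m * dist (surface 0 0) (surface 0 1)]
  xi_axis : 0 < (partialT D 0 0) 0

/-- The edge of regression, on the unrolled surface: the points `(t, m)` at which the
parametrization is singular, i.e. where its derivative in `t` has the direction of the generating
line. The one-sided derivative only matters where two pieces meet, `|h t| = 2π/3`. -/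
def edgeOfRegression : Set (ℝ × ℝ) :=
  {p | ∃ v : Space, HasDerivWithinAt (fun τ => surface τ p.2) v (Ici p.1) p.1 ∧
    ∃ r : ℝ, v = r • (surface p.1 1 - surface p.1 0)}

def gTilde₁ (t : ℝ) : ℝ :=
  2 * √3 / 9 * (arccos (√2 * cos t / √(1 + cos t)) -
    (2 + 2 * cos t - cos t ^ 2) * √(2 * (1 + 2 * cos t)) * |sin t| /
      (3 * cos t * (1 + cos t) ^ (3 / 2 : ℝ)))

def gTilde₂ (t : ℝ) : ℝ :=
  √3 / 9 * (log (2 / (1 + cos t)) +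
    (7 + 33 * cos t + 18 * cos t ^ 2 - 4 * cos t ^ 3) / (3 * cos t * (1 + cos t)))

def gStar₁ (t : ℝ) : ℝ :=
  pieceIndex t * (4 * π / (3 * √3)) + Real.sign (h t) * gTilde₁ (h t)

def gStar₂ (t : ℝ) : ℝ := gTilde₂ (h t)

/-- The parametrization of the plane curve `R*`; the poles are the `t` with `cos (h t) = 0`. -/
def gStar (t : ℝ) : Plane := !₂[gStar₁ t, gStar₂ t]

end Oloid

end

noncomputable section

namespace Oloid

open Filter Topology

/-! Write t for the local parameter `h t`, and put c = cos t, C = cos(t/2), W = √(1+2c). Inside a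
piece the surface is X = foot + m d with |d|² = 3. Its t-derivative has ⟨d, ∂ₜX⟩ = tan(t/2) for
every m. Its part orthogonal to d has signed length √3 λ, where λ = W/(3C) − m c/(WC)
(`inner_direction_velocity`, `inner_velocity`, `volume3_normalPiece`). The unit normal depends on t
alone, which is developability.

A development must therefore send d to a plane vector b of the same length with b' = −(c/(WC)) rot
b, and the foot to a curve with velocity (tan(t/2)/3) b + (W/(3C)) rot b. These equations integrate
in closed form to `devDirection` and `devFoot`, and the constants in `devFoot` make the pieces fit
together.

For uniqueness, isometric images of lines are affine in m. The sign of the orientation is constant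
by connectedness and is fixed by the ξ-axis. Two developments then solve the same equations off the
countable set of joints, with the same initial line.

Inside a piece, a point is singular exactly when λ = 0, that is, m = (1+2c)/(3c). At a joint W = 0
and the square root destroys differentiability unless m = 0, which is what the same formula gives.
Substituting this m into the development produces `gStar`. -/

/-! ### Pieces of the parameter line and gluing at the joints. -/

theorem pieceIndex_neg (t : ℝ) : pieceIndex (-t) = -pieceIndex t := by
  simp [pieceIndex, Left.sign_neg]

theorem h_neg (t : ℝ) : h (-t) = -h t := by
  simp only [h, pieceIndex_neg]; push_cast; ring

theorem abs_h_le (t : ℝ) : |h t| ≤ 2 * π / 3 := by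
  have key : ∀ t : ℝ, 0 < t → |h t| ≤ 2 * π / 3 := by
    intro t ht
    have hk : pieceIndex t = ⌊3 * t / (4 * π) + 1 / 2⌋ := by
      simp [pieceIndex, sign_pos ht, abs_of_pos ht]
    have h1 := Int.floor_le (3 * t / (4 * π) + 1 / 2)
    have h2 := Int.lt_floor_add_one (3 * t / (4 * π) + 1 / 2)
    rw [← hk] at h1 h2
    have hπ := pi_pos
    have e : t = (3 * t / (4 * π)) * (4 * π / 3) := by field_simp
    have h3 := mul_nonneg (sub_nonneg.2 h1) hπ.le
    have h4 := mul_nonneg (sub_nonneg.2 h2.le) hπ.le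
    set x := 3 * t / (4 * π)
    rw [abs_le, h]
    constructor <;> nlinarith
  rcases lt_trichotomy t 0 with ht | rfl | ht
  · rw [← neg_neg t, h_neg, abs_neg]
    exact key _ (by linarith)
  · have := pi_pos
    simp [h, pieceIndex]; positivity
  · exact key t ht

theorem h_eq (t : ℝ) : h t = t - pieceIndex t * (4 * π / 3) := rfl

/-- Pieces have length 4π/3, so two that contain t have indices differing by at most 1, and they
differ only if t is the common endpoint. -/
theorem pieceIndex_cases {t : ℝ} {k : ℤ} (hk : |t - k * (4 * π / 3)| ≤ 2 * π / 3) :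
    pieceIndex t = k ∨
    (pieceIndex t = k + 1 ∧ t - k * (4 * π / 3) = 2 * π / 3 ∧ h t = -(2 * π / 3)) ∨
    (pieceIndex t = k - 1 ∧ t - k * (4 * π / 3) = -(2 * π / 3) ∧ h t = 2 * π / 3) := by
  have h0 := abs_h_le t
  have hπ := pi_pos
  rw [h_eq] at *
  set n := pieceIndex t
  rw [abs_le] at *
  have h1 : (n : ℝ) - k ≤ 1 := by by_contra! hc; nlinarith
  have h2 : (-1 : ℝ) ≤ n - k := by by_contra! hc; nlinarith
  have h1' : n - k ≤ 1 := by exact_mod_cast h1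
  have h2' : -1 ≤ n - k := by exact_mod_cast h2
  obtain hn | hn | hn : n = k ∨ n = k + 1 ∨ n = k - 1 := by omega
  · exact Or.inl hn
  · refine Or.inr (Or.inl ⟨hn, ?_⟩)
    have : (n : ℝ) = k + 1 := by exact_mod_cast hn
    rw [this] at h0 ⊢
    constructor <;> linarith
  · refine Or.inr (Or.inr ⟨hn, ?_⟩)
    have : (n : ℝ) = k - 1 := by exact_mod_cast hn
    rw [this] at h0 ⊢
    constructor <;> linarith

theorem pieceIndex_eq {t : ℝ} {k : ℤ} (hk : |t - k * (4 * π / 3)| < 2 * π / 3) :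
    pieceIndex t = k := by
  rcases pieceIndex_cases hk.le with h1 | ⟨-, h1, -⟩ | ⟨-, h1, -⟩
  · exact h1
  · rw [h1] at hk; exact absurd (le_abs_self _) (not_le.2 hk)
  · rw [h1, abs_neg] at hk; exact absurd (le_abs_self _) (not_le.2 hk)

theorem eventually_pieceIndex {t : ℝ} (ht : |h t| < 2 * π / 3) :
    ∀ᶠ τ in 𝓝 t, pieceIndex τ = pieceIndex t := by
  have : ContinuousAt (fun τ : ℝ => |τ - pieceIndex t * (4 * π / 3)|) t := by fun_prop
  filter_upwards [this.eventually_lt continuousAt_const ht] with τ hτ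
  exact pieceIndex_eq hτ

/-- Functions given on the pieces which agree at the joints. -/
structure Compatible {X : Type*} (f : ℤ → ℝ → X) : Prop where
  joint : ∀ k, f k (2 * π / 3) = f (k + 1) (-(2 * π / 3))

/-- A joint may be read from either neighbouring piece, so the choice made by the floor function is
immaterial. -/
theorem Compatible.eq_piece {X : Type*} {f : ℤ → ℝ → X} (hf : Compatible f) {t : ℝ} {k : ℤ}
    (hk : |t - k * (4 * π / 3)| ≤ 2 * π / 3) :
    f (pieceIndex t) (h t) = f k (t - k * (4 * π / 3)) := by
  rcases pieceIndex_cases hk with h1 | ⟨h1, h2, h3⟩ | ⟨h1, h2, h3⟩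
  · rw [h_eq, h1]
  · rw [h1, h2, h3, hf.joint]
  · rw [h1, h2, h3, hf.joint, sub_add_cancel]

theorem exists_piece_right (t : ℝ) : ∃ k : ℤ, -(2 * π / 3) ≤ t - k * (4 * π / 3) ∧
    t - k * (4 * π / 3) < 2 * π / 3 := by
  have hπ := pi_pos
  have h1 := Int.floor_le (3 * t / (4 * π) + 1 / 2)
  have h2 := Int.lt_floor_add_one (3 * t / (4 * π) + 1 / 2)
  have e : t = (3 * t / (4 * π)) * (4 * π / 3) := by field_simp
  refine ⟨⌊3 * t / (4 * π) + 1 / 2⌋, ?_⟩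
  set k := ⌊3 * t / (4 * π) + 1 / 2⌋
  set x := 3 * t / (4 * π)
  rw [e]
  constructor <;> nlinarith

theorem exists_piece_left (t : ℝ) : ∃ k : ℤ, -(2 * π / 3) < t - k * (4 * π / 3) ∧
    t - k * (4 * π / 3) ≤ 2 * π / 3 := by
  obtain ⟨k, h1, h2⟩ := exists_piece_right (-t)
  refine ⟨-k, ?_, ?_⟩ <;> push_cast <;> linarith

theorem Compatible.continuous {X : Type*} [TopologicalSpace X] {f : ℤ → ℝ → X}
    (hf : Compatible f) (hc : ∀ k, ContinuousOn (f k) (Icc (-(2 * π / 3)) (2 * π / 3))) :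
    Continuous (fun t => f (pieceIndex t) (h t)) := by
  have main : ∀ k : ℤ, ContinuousOn (fun t => f (pieceIndex t) (h t))
      (Icc (k * (4 * π / 3) - 2 * π / 3) (k * (4 * π / 3) + 2 * π / 3)) := by
    intro k
    have : ContinuousOn (fun t : ℝ => f k (t - k * (4 * π / 3)))
        (Icc (k * (4 * π / 3) - 2 * π / 3) (k * (4 * π / 3) + 2 * π / 3)) := by
      refine (hc k).comp (by fun_prop) ?_
      rintro t ⟨h1, h2⟩
      constructor <;> linarith
    refine this.congr ?_
    rintro t ⟨h1, h2⟩
    exact hf.eq_piece (abs_le.2 ⟨by linarith, by linarith⟩)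
  rw [continuous_iff_continuousAt]
  intro t
  rw [continuousAt_iff_continuous_left_right]
  -- At a joint the two sides are served by different pieces.
  constructor
  · obtain ⟨k, h1, h2⟩ := exists_piece_left t
    refine ((main k) t ⟨by linarith, by linarith⟩).mono_of_mem_nhdsWithin ?_
    exact mem_of_superset (Icc_mem_nhdsLE (show k * (4 * π / 3) - 2 * π / 3 < t by linarith))
      (Icc_subset_Icc_right (by linarith))
  · obtain ⟨k, h1, h2⟩ := exists_piece_right t
    refine ((main k) t ⟨by linarith, by linarith⟩).mono_of_mem_nhdsWithin ?_
    exact mem_of_superset (Icc_mem_nhdsGE (show t < k * (4 * π / 3) + 2 * π / 3 by linarith))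
      (Icc_subset_Icc_left (by linarith))

/-- A function of the pieces has the derivative of its piece inside the pieces. -/
theorem hasDerivAt_piece {F : Type*} [NormedAddCommGroup F] [NormedSpace ℝ F] {f : ℤ → ℝ → F}
    {t : ℝ} (ht : |h t| < 2 * π / 3) {f' : F} (hf : HasDerivAt (f (pieceIndex t)) f' (h t)) :
    HasDerivAt (fun τ => f (pieceIndex τ) (h τ)) f' t := by
  have h1 : HasDerivAt (fun τ : ℝ => f (pieceIndex t) (τ - pieceIndex t * (4 * π / 3))) f' t :=
    HasDerivAt.comp_sub_const (f := f (pieceIndex t)) t _ hf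
  refine h1.congr_of_eventuallyEq ?_
  filter_upwards [eventually_pieceIndex ht] with τ hτ
  rw [h_eq, hτ]

theorem countable_joints : {t : ℝ | ¬ |h t| < 2 * π / 3}.Countable := by
  refine ((countable_range fun k : ℤ => k * (4 * π / 3) + 2 * π / 3).union
    (countable_range fun k : ℤ => k * (4 * π / 3) - 2 * π / 3)).mono ?_
  intro t ht
  have h1 : |h t| = 2 * π / 3 := le_antisymm (abs_h_le t) (not_lt.1 ht)
  rcases (abs_eq (by positivity)).1 h1 with h2 | h2
  · exact Or.inl ⟨pieceIndex t, by simp only; rw [← h2, h_eq]; ring⟩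
  · exact Or.inr ⟨pieceIndex t, by simp only; rw [h_eq] at h2; linarith⟩

theorem dense_interior : Dense {t : ℝ | |h t| < 2 * π / 3} := by
  have := countable_joints.dense_compl ℝ
  rwa [compl_ofPred, show {t : ℝ | ¬ ¬ |h t| < 2 * π / 3} = {t : ℝ | |h t| < 2 * π / 3} by
    simp only [not_not]] at this

/-- Nothing is known about derivatives at the joints, but they are countable and f is continuous, so
the fundamental theorem of calculus still applies. -/
theorem eq_of_hasDerivAt_zero {f : ℝ → ℝ} (hc : Continuous f)
    (hd : ∀ t, |h t| < 2 * π / 3 → HasDerivAt f 0 t) (t : ℝ) : f t = f 0 := by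
  have key : ∀ a b : ℝ, a ≤ b → f b = f a := by
    intro a b hab
    have := MeasureTheory.integral_eq_of_hasDerivAt_off_countable_of_le f (fun _ => (0 : ℝ)) hab
      countable_joints hc.continuousOn (fun x hx => hd x (not_not.1 hx.2)) (by simp)
    simp at this
    linarith
  rcases le_total 0 t with ht | ht
  · exact key _ _ ht
  · exact (key _ _ ht).symm

theorem pieceIndex_zero : pieceIndex 0 = 0 := by simp [pieceIndex]

theorem h_zero : h 0 = 0 := by simp [h, pieceIndex_zero]

theorem abs_h_zero_lt : |h 0| < 2 * π / 3 := by
  rw [h_zero, abs_zero]; positivity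

/-! ### Half-angle formulas and the square root. -/

theorem cos_joint : cos (2 * π / 3) = -1 / 2 := by
  rw [show 2 * π / 3 = π - π / 3 by ring, cos_pi_sub, cos_pi_div_three]; ring

theorem half_le_cos_half {t : ℝ} (ht : |t| ≤ 2 * π / 3) : 1 / 2 ≤ cos (t / 2) := by
  rw [← cos_abs, ← cos_pi_div_three, abs_div, abs_two]
  have := pi_pos
  exact cos_le_cos_of_nonneg_of_le_pi (by positivity) (by linarith) (by linarith)

theorem half_lt_cos_half {t : ℝ} (ht : |t| < 2 * π / 3) : 1 / 2 < cos (t / 2) := by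
  rw [← cos_abs, ← cos_pi_div_three, abs_div, abs_two]
  have := pi_pos
  exact cos_lt_cos_of_nonneg_of_le_pi (by positivity) (by linarith) (by linarith)

theorem cos_eq_half (t : ℝ) : cos t = 2 * cos (t / 2) ^ 2 - 1 := by
  rw [← cos_two_mul]; ring_nf

theorem sin_eq_half (t : ℝ) : sin t = 2 * sin (t / 2) * cos (t / 2) := by
  rw [← sin_two_mul]; ring_nf

/-- The square root in `beta`. -/
def root (t : ℝ) : ℝ := √(1 + 2 * cos t)

/-- Together with sin² = 1 − cos² at t/2, this reduces the later metric identities to rational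
identities in cos(t/2). -/
theorem root_sq {t : ℝ} (ht : |t| ≤ 2 * π / 3) : root t ^ 2 = 4 * cos (t / 2) ^ 2 - 1 := by
  have := half_le_cos_half ht
  rw [root, sq_sqrt, cos_eq_half]
  · ring
  · rw [cos_eq_half]; nlinarith

theorem root_pos {t : ℝ} (ht : |t| < 2 * π / 3) : 0 < root t := by
  have := half_lt_cos_half ht
  rw [root, cos_eq_half]
  apply sqrt_pos.2
  nlinarith

theorem root_joint : root (2 * π / 3) = 0 := by
  rw [root, cos_joint]; norm_num

theorem root_neg (t : ℝ) : root (-t) = root t := by simp [root]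

theorem continuous_root : Continuous root := by unfold root; fun_prop

theorem hasDerivAt_root {t : ℝ} (ht : |t| < 2 * π / 3) :
    HasDerivAt root (-sin t / root t) t := by
  have h0 := root_pos ht
  have h1 : HasDerivAt (fun t => 1 + 2 * cos t) (2 * -sin t) t :=
    ((hasDerivAt_cos t).const_mul 2).const_add 1
  have h2 := h1.sqrt (fun h => by rw [root, h] at h0; simp at h0)
  have h3 : HasDerivAt root (2 * -sin t / (2 * root t)) t := h2
  convert h3 using 1
  field_simp

/-! ### First fundamental form of the surface. -/

theorem neg_one_zpow_sq (k : ℤ) : ((-1 : ℝ) ^ k) ^ 2 = 1 := by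
  rw [← zpow_natCast, ← zpow_mul, mul_comm, zpow_mul]; norm_num

theorem neg_one_zpow_succ (k : ℤ) : (-1 : ℝ) ^ (k + 1) = -(-1) ^ k := by
  rw [zpow_add_one₀ (by norm_num)]; ring

/-- The `k`-th piece of the unrolled surface, as a function of `h t`. -/
def surfacePiece (m : ℝ) (k : ℤ) (t : ℝ) : Space :=
  !₂[(-1) ^ k * omega m t 0, omega m t 1, -((-1) ^ k * omega m t 2)]

/-- The direction of the generating lines. -/
def direction (k : ℤ) (t : ℝ) : Space :=
  !₂[-((-1) ^ k * sin t), 1 + cos t - cos t / (1 + cos t), -((-1) ^ k * (root t / (1 + cos t)))]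

/-- The derivative of the surface with respect to `t`. -/
def velocity (m : ℝ) (k : ℤ) (t : ℝ) : Space :=
  !₂[(-1) ^ k * ((1 - m) * cos t), (1 - m) * sin t + m * (sin t / (1 + cos t) ^ 2),
    -((-1) ^ k * (m * (sin t * cos t / (root t * (1 + cos t) ^ 2))))]

theorem surface_eq (t m : ℝ) : surface t m = surfacePiece m (pieceIndex t) (h t) := rfl

theorem surfacePiece_apply_two (m : ℝ) (k : ℤ) (t : ℝ) :
    surfacePiece m k t 2 = -((-1) ^ k * (m * (root t / (1 + cos t)))) := by
  simp [surfacePiece, omega, alpha, beta, root]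

theorem surfacePiece_eq (m : ℝ) (k : ℤ) (t : ℝ) :
    surfacePiece m k t = surfacePiece 0 k t + m • direction k t := by
  ext i
  fin_cases i <;> simp [surfacePiece, omega, alpha, beta, direction, root] <;> ring

theorem surface_eq_add (t m : ℝ) :
    surface t m = surface t 0 + m • direction (pieceIndex t) (h t) := by
  rw [surface_eq, surface_eq, surfacePiece_eq]

/-- The change of sign between pieces is absorbed because ω₁ is odd and ω₃ vanishes at the joints.
-/
theorem compatible_surfacePiece (m : ℝ) : Compatible (surfacePiece m) where
  joint k := by
    have := root_joint
    rw [root] at this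
    ext i
    fin_cases i <;> simp [surfacePiece, omega, alpha, beta, this, neg_one_zpow_succ]

theorem hasDerivAt_space {f : ℝ → Space} {f' : Space} {t : ℝ}
    (h0 : HasDerivAt (fun τ => f τ 0) (f' 0) t) (h1 : HasDerivAt (fun τ => f τ 1) (f' 1) t)
    (h2 : HasDerivAt (fun τ => f τ 2) (f' 2) t) : HasDerivAt f f' t := by
  have : HasDerivAt (fun τ i => f τ i) (fun i => f' i) t :=
    hasDerivAt_pi.2 fun i => by fin_cases i <;> assumption
  exact (PiLp.continuousLinearEquiv 2 ℝ (fun _ => ℝ)).symm.toContinuousLinearMap.hasFDerivAt.comp_hasDerivAt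
    t this

theorem hasDerivAt_plane {f : ℝ → Plane} {f' : Plane} {t : ℝ}
    (h0 : HasDerivAt (fun τ => f τ 0) (f' 0) t) (h1 : HasDerivAt (fun τ => f τ 1) (f' 1) t) :
    HasDerivAt f f' t := by
  have : HasDerivAt (fun τ i => f τ i) (fun i => f' i) t :=
    hasDerivAt_pi.2 fun i => by fin_cases i <;> assumption
  exact (PiLp.continuousLinearEquiv 2 ℝ (fun _ => ℝ)).symm.toContinuousLinearMap.hasFDerivAt.comp_hasDerivAt
    t this

theorem hasDerivAt_apply {n : ℕ} {f : ℝ → EuclideanSpace ℝ (Fin n)} {f' : EuclideanSpace ℝ (Fin n)}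
    {t : ℝ} (hf : HasDerivAt f f' t) (i : Fin n) : HasDerivAt (fun τ => f τ i) (f' i) t :=
  (EuclideanSpace.proj (𝕜 := ℝ) i).hasFDerivAt.comp_hasDerivAt t hf

theorem inner_plane (u v : Plane) : ⟪u, v⟫ = u 0 * v 0 + u 1 * v 1 := by
  simp [PiLp.inner_apply, Fin.sum_univ_two]; ring

theorem inner_space (u v : Space) : ⟪u, v⟫ = u 0 * v 0 + u 1 * v 1 + u 2 * v 2 := by
  simp [PiLp.inner_apply, Fin.sum_univ_three]; ring

theorem one_add_cos_pos {t : ℝ} (ht : |t| ≤ 2 * π / 3) : 0 < 1 + cos t := by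
  have := half_le_cos_half ht
  rw [cos_eq_half]; nlinarith

theorem hasDerivAt_surfacePiece (m : ℝ) (k : ℤ) {t : ℝ} (ht : |t| < 2 * π / 3) :
    HasDerivAt (surfacePiece m k) (velocity m k t) t := by
  have hc := one_add_cos_pos ht.le
  have hr := root_pos ht
  have hr2 : root t ^ 2 = 1 + 2 * cos t := by rw [root_sq ht.le, cos_eq_half t]; ring
  have hcos : HasDerivAt (fun t => 1 + cos t) (-sin t) t := (hasDerivAt_cos t).const_add 1
  refine hasDerivAt_space ?_ ?_ ?_
  · have := ((hasDerivAt_sin t).const_mul (1 - m)).const_mul ((-1 : ℝ) ^ k)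
    simpa [surfacePiece, omega, alpha, beta, velocity] using this
  · have := (((hasDerivAt_cos t).const_sub (-1 / 2)).const_mul (1 - m)).add
      ((((hasDerivAt_cos t).div hcos hc.ne').const_sub (1 / 2)).const_mul m)
    have e : (fun τ => surfacePiece m k τ 1) = fun τ => (1 - m) * (-1 / 2 - cos τ) +
        m * (1 / 2 - cos τ / (1 + cos τ)) := by
      funext τ; simp [surfacePiece, omega, alpha, beta]
    rw [e]
    refine this.congr_deriv ?_
    change _ = (1 - m) * sin t + m * (sin t / (1 + cos t) ^ 2)
    field_simp
    ring
  · have := ((((hasDerivAt_root ht).div hcos hc.ne').const_mul m).const_mul ((-1 : ℝ) ^ k)).neg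
    simp only [surfacePiece_apply_two]
    refine this.congr_deriv ?_
    change _ = -((-1) ^ k * (m * (sin t * cos t / (root t * (1 + cos t) ^ 2))))
    field_simp
    rw [hr2]; ring

theorem hasDerivAt_surface {t : ℝ} (ht : |h t| < 2 * π / 3) (m : ℝ) :
    HasDerivAt (fun τ => surface τ m) (velocity m (pieceIndex t) (h t)) t :=
  hasDerivAt_piece ht (hasDerivAt_surfacePiece m _ ht)

theorem partialT_surface {t : ℝ} (ht : |h t| < 2 * π / 3) (m : ℝ) :
    partialT surface t m = velocity m (pieceIndex t) (h t) :=
  (hasDerivAt_surface ht m).deriv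

theorem hasDerivAt_line {F : Type*} [NormedAddCommGroup F] [NormedSpace ℝ F] (a b : F) (m : ℝ) :
    HasDerivAt (fun μ : ℝ => a + μ • b) b m := by
  simpa using ((hasDerivAt_id m).smul_const b).const_add a

theorem partialM_surface (t m : ℝ) :
    partialM surface t m = direction (pieceIndex t) (h t) := by
  rw [partialM, show (fun μ => surface t μ) = fun μ => surface t 0 + μ •
    direction (pieceIndex t) (h t) from funext (surface_eq_add t)]
  exact (hasDerivAt_line _ _ m).deriv

theorem inner_direction (k : ℤ) {t : ℝ} (ht : |t| ≤ 2 * π / 3) :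
    ⟪direction k t, direction k t⟫ = 3 := by
  have hC := half_le_cos_half ht
  have hC0 : cos (t / 2) ≠ 0 := by positivity
  have hr := root_sq ht
  have he := neg_one_zpow_sq k
  have hy := sin_sq_add_cos_sq (t / 2)
  rw [inner_space]
  simp only [direction, PiLp.toLp_apply, Matrix.cons_val]
  rw [cos_eq_half t, sin_eq_half t]
  set C := cos (t / 2)
  set y := sin (t / 2)
  have hy2 : y ^ 2 = 1 - C ^ 2 := by linarith
  field_simp
  simp only [he, hr, hy2]
  ring_nf

theorem inner_direction_velocity (m : ℝ) (k : ℤ) {t : ℝ} (ht : |t| < 2 * π / 3) :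
    ⟪direction k t, velocity m k t⟫ = sin (t / 2) / cos (t / 2) := by
  have hC := half_le_cos_half ht.le
  have hC0 : cos (t / 2) ≠ 0 := by positivity
  have hr0 := (root_pos ht).ne'
  have he := neg_one_zpow_sq k
  rw [inner_space]
  simp only [direction, velocity, PiLp.toLp_apply, Matrix.cons_val]
  rw [cos_eq_half t, sin_eq_half t]
  set C := cos (t / 2)
  set y := sin (t / 2)
  field_simp
  simp only [he]
  ring

/-- The first summand is ⟨d, v⟩²/3 for the direction d and velocity v. The second is the squared
length of the part of v orthogonal to d, a perfect square of a function affine in m. -/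
theorem inner_velocity (m : ℝ) (k : ℤ) {t : ℝ} (ht : |t| < 2 * π / 3) :
    ⟪velocity m k t, velocity m k t⟫ = (sin (t / 2) / cos (t / 2)) ^ 2 / 3 +
      3 * (root t / (3 * cos (t / 2)) - m * (cos t / (root t * cos (t / 2)))) ^ 2 := by
  have hC := half_le_cos_half ht.le
  have hC0 : cos (t / 2) ≠ 0 := by positivity
  have hr := root_sq ht.le
  have hr0 := (root_pos ht).ne'
  have he := neg_one_zpow_sq k
  have hy := sin_sq_add_cos_sq (t / 2)
  have hr4 : root t ^ 4 = (4 * cos (t / 2) ^ 2 - 1) ^ 2 := by rw [← hr]; ring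
  rw [inner_space]
  simp only [velocity, PiLp.toLp_apply, Matrix.cons_val]
  rw [cos_eq_half t, sin_eq_half t]
  set C := cos (t / 2)
  set y := sin (t / 2)
  have hy2 : y ^ 2 = 1 - C ^ 2 := by linarith
  field_simp
  ring_nf
  simp only [he, hr, hy2, hr4]
  ring

/-! ### The unit normal field. -/

/-- The unit normal on the `k`-th piece. -/
def normalPiece (k : ℤ) (t : ℝ) : Space :=
  !₂[-((-1) ^ k * (sin t / (2 * cos (t / 2)))), cos t / (2 * cos (t / 2)),
    (-1) ^ k * (root t / (2 * cos (t / 2)))]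

theorem compatible_normalPiece : Compatible normalPiece where
  joint k := by
    have hc := cos_joint
    have hr := root_joint
    ext i
    fin_cases i <;> simp [normalPiece, neg_one_zpow_succ, root_neg, hr, neg_div]

theorem inner_normalPiece (k : ℤ) {t : ℝ} (ht : |t| ≤ 2 * π / 3) :
    ⟪normalPiece k t, normalPiece k t⟫ = 1 := by
  have hC := half_le_cos_half ht
  have hC0 : cos (t / 2) ≠ 0 := by positivity
  have hr := root_sq ht
  have he := neg_one_zpow_sq k
  have hs := sin_sq_add_cos_sq t
  rw [inner_space]
  simp only [normalPiece, PiLp.toLp_apply, Matrix.cons_val]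
  field_simp
  simp only [he, hr]
  linarith

/-- This recovers the sign of the transverse component, of which `inner_velocity` sees only the
square. -/
theorem volume3_normalPiece (m : ℝ) (k : ℤ) {t : ℝ} (ht : |t| < 2 * π / 3) :
    volume3 (normalPiece k t) (direction k t) (velocity m k t) =
      -(3 * (root t / (3 * cos (t / 2)) - m * (cos t / (root t * cos (t / 2))))) := by
  have hC := half_le_cos_half ht.le
  have hC0 : cos (t / 2) ≠ 0 := by positivity
  have hr := root_sq ht.le
  have hr0 := (root_pos ht).ne'
  have he := neg_one_zpow_sq k
  have hy := sin_sq_add_cos_sq (t / 2)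
  simp only [volume3, normalPiece, direction, velocity, PiLp.toLp_apply, Matrix.cons_val]
  rw [cos_eq_half t, sin_eq_half t]
  set C := cos (t / 2)
  set y := sin (t / 2)
  have hy2 : y ^ 2 = 1 - C ^ 2 := by linarith
  field_simp
  ring_nf
  simp only [he, hr, hy2]
  ring

theorem inner_normalPiece_direction (k : ℤ) {t : ℝ} (ht : |t| ≤ 2 * π / 3) :
    ⟪normalPiece k t, direction k t⟫ = 0 := by
  have hC := half_le_cos_half ht
  have hC0 : cos (t / 2) ≠ 0 := by positivity
  have hr := root_sq ht
  have he := neg_one_zpow_sq k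
  have hy := sin_sq_add_cos_sq (t / 2)
  rw [inner_space]
  simp only [normalPiece, direction, PiLp.toLp_apply, Matrix.cons_val]
  rw [cos_eq_half t, sin_eq_half t]
  set C := cos (t / 2)
  set y := sin (t / 2)
  have hy2 : y ^ 2 = 1 - C ^ 2 := by linarith
  field_simp
  simp only [he, hr, hy2]
  ring

theorem inner_normalPiece_velocity (m : ℝ) (k : ℤ) {t : ℝ} (ht : |t| < 2 * π / 3) :
    ⟪normalPiece k t, velocity m k t⟫ = 0 := by
  have hC := half_le_cos_half ht.le
  have hC0 : cos (t / 2) ≠ 0 := by positivity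
  have hr0 := (root_pos ht).ne'
  have he := neg_one_zpow_sq k
  rw [inner_space]
  simp only [normalPiece, velocity, PiLp.toLp_apply, Matrix.cons_val]
  rw [cos_eq_half t, sin_eq_half t]
  field_simp
  simp only [he]
  ring

/-- The unit normal which points to positive `y` at `t = 0`. -/
def normal (t : ℝ) : Space := normalPiece (pieceIndex t) (h t)

theorem abs_le_of_mem_Icc {t : ℝ} (ht : t ∈ Icc (-(2 * π / 3)) (2 * π / 3)) :
    |t| ≤ 2 * π / 3 := abs_le.2 ht

theorem continuous_normal : Continuous normal := by
  refine compatible_normalPiece.continuous fun k => ?_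
  have hne : ∀ t ∈ Icc (-(2 * π / 3)) (2 * π / 3), 2 * cos (t / 2) ≠ 0 := by
    intro t ht
    have := half_le_cos_half (abs_le_of_mem_Icc ht)
    positivity
  have hr := continuous_root
  unfold normalPiece
  refine (PiLp.continuous_toLp 2 _).comp_continuousOn (continuousOn_pi.2 fun i => ?_)
  fin_cases i <;> simp <;> fun_prop (disch := assumption)

theorem isUnitNormal_normal : IsUnitNormal normal where
  continuous := continuous_normal
  norm_eq_one t := by
    rw [norm_eq_sqrt_real_inner, normal, inner_normalPiece _ (abs_h_le t), sqrt_one]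
  orthogonal t ht m := by
    rw [partialM_surface, partialT_surface ht]
    exact ⟨inner_normalPiece_direction _ ht.le, inner_normalPiece_velocity m _ ht⟩

theorem dist_surface (t m m' : ℝ) : dist (surface t m) (surface t m') = √3 * |m - m'| := by
  rw [surface_eq_add t m, surface_eq_add t m', dist_add_left, dist_eq_norm, ← sub_smul, norm_smul,
    norm_eq_sqrt_real_inner (direction _ _), inner_direction _ (abs_h_le t), norm_eq_abs, mul_comm]

/-! ### The explicit development. -/

/-- The angle whose cosine is `√2 cos t / √(1 + cos t)` and whose sign is that of `t`. -/
def angle (t : ℝ) : ℝ := arcsin (2 * sin (t / 2) / √3) + arcsin (sin (t / 2) / (√3 * cos (t / 2)))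

theorem hasDerivAt_sin_half (t : ℝ) :
    HasDerivAt (fun t => sin (t / 2)) (cos (t / 2) / 2) t := by
  refine ((hasDerivAt_id t).div_const 2).sin.congr_deriv ?_
  change cos (t / 2) * (1 / 2) = _
  ring

theorem hasDerivAt_cos_half (t : ℝ) :
    HasDerivAt (fun t => cos (t / 2)) (-(sin (t / 2) / 2)) t := by
  refine ((hasDerivAt_id t).div_const 2).cos.congr_deriv ?_
  change -sin (t / 2) * (1 / 2) = _
  ring

theorem hasDerivAt_arcsin_of_sq {f : ℝ → ℝ} {f' t w : ℝ} (hf : HasDerivAt f f' t) (hw : 0 < w)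
    (h : 1 - f t ^ 2 = w ^ 2) : HasDerivAt (fun τ => arcsin (f τ)) (f' / w) t := by
  have h1 : f t ≠ -1 := fun h1 => by rw [h1] at h; nlinarith
  have h2 : f t ≠ 1 := fun h1 => by rw [h1] at h; nlinarith
  have := (hasDerivAt_arcsin h1 h2).comp t hf
  rw [h, sqrt_sq hw.le] at this
  refine this.congr_deriv ?_
  ring

/-- For both arcsines, 1 − x² is a multiple of `root t ^ 2`, by 1/3 and by 1/(3 cos²(t/2)), so their
derivatives share the denominator `root t`. -/
theorem hasDerivAt_angle {t : ℝ} (ht : |t| < 2 * π / 3) :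
    HasDerivAt angle ((2 * cos (t / 2) ^ 2 + 1) / (2 * cos (t / 2) * root t)) t := by
  have hC := half_lt_cos_half ht
  have hC0 : 0 < cos (t / 2) := by linarith
  have hr := root_sq ht.le
  have hr0 := root_pos ht
  have hy := sin_sq_add_cos_sq (t / 2)
  have h3 : (√3 : ℝ) ^ 2 = 3 := sq_sqrt (by norm_num)
  have h30 : 0 < √(3 : ℝ) := by positivity
  have d1 := hasDerivAt_arcsin_of_sq (w := root t / √3)
    (((hasDerivAt_sin_half t).const_mul 2).div_const √3) (by positivity)
    (by field_simp; rw [hr, h3]; linarith)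
  have d2 := hasDerivAt_arcsin_of_sq (w := root t / (√3 * cos (t / 2)))
    ((hasDerivAt_sin_half t).div ((hasDerivAt_cos_half t).const_mul √3) (by positivity))
    (by positivity)
    (by simp only [Pi.div_apply]; field_simp; rw [hr, h3]; linarith)
  refine (d1.add d2).congr_deriv ?_
  field_simp
  linarith

/-- The developed generating lines, as vectors. -/
def devDirection (t : ℝ) : Plane :=
  !₂[-(√3 * (2 * sin (t / 2) * root t * (1 + 2 * cos (t / 2) ^ 2) / (9 * cos (t / 2) ^ 2))),
    √3 * ((8 * cos (t / 2) ^ 4 - cos (t / 2) ^ 2 + 2) / (9 * cos (t / 2) ^ 2))]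

/-- The developed circle. -/
def devFoot (k : ℤ) (t : ℝ) : Plane :=
  !₂[k * (4 * π / (3 * √3)) + 2 * √3 / 9 * (angle t + 2 * sin (t / 2) * root t),
    √3 / 9 * (8 * (1 - cos (t / 2) ^ 2) - 2 * log (cos (t / 2)))]

/-- Rotation of the plane by a right angle, clockwise. -/
def rot (u : Plane) : Plane := !₂[u 1, -u 0]

/-- The turning rate is the coefficient of m in the transverse velocity of the surface. -/
theorem hasDerivAt_devDirection {t : ℝ} (ht : |t| < 2 * π / 3) :
    HasDerivAt devDirection (-(cos t / (root t * cos (t / 2))) • rot (devDirection t)) t := by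
  have hC := half_lt_cos_half ht
  have hC0 : 0 < cos (t / 2) := by linarith
  have hr := root_sq ht.le
  have hr0 := root_pos ht
  have hy := sin_sq_add_cos_sq (t / 2)
  have hy2 : sin (t / 2) ^ 2 = 1 - cos (t / 2) ^ 2 := by linarith
  have hden := ((hasDerivAt_cos_half t).pow 2).const_mul 9
  have hden0 : 9 * cos (t / 2) ^ 2 ≠ 0 := by positivity
  refine hasDerivAt_plane ?_ ?_
  · have := (((((((hasDerivAt_sin_half t).const_mul 2).mul (hasDerivAt_root ht)).mul
      ((((hasDerivAt_cos_half t).pow 2).const_mul 2).const_add 1)).div hden hden0).const_mul √3).neg)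
    refine this.congr_deriv ?_
    simp only [rot, devDirection, PiLp.smul_apply, PiLp.toLp_apply, Matrix.cons_val, smul_eq_mul,
      Pi.mul_apply, Pi.pow_apply]
    rw [cos_eq_half t, sin_eq_half t]
    generalize cos (t / 2) = C at *
    generalize sin (t / 2) = y at *
    field_simp
    ring_nf
    simp only [hr, hy2]
    ring
  · have := (((((((hasDerivAt_cos_half t).pow 4).const_mul 8).sub ((hasDerivAt_cos_half t).pow 2)).add_const 2).div
      hden hden0).const_mul √3)
    refine this.congr_deriv ?_
    simp only [rot, devDirection, PiLp.smul_apply, PiLp.toLp_apply, Matrix.cons_val, smul_eq_mul,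
      Pi.sub_apply, Pi.pow_apply]
    rw [cos_eq_half t]
    field_simp
    ring_nf

/-- The two coefficients are the components of the velocity of the surface at m = 0. -/
theorem hasDerivAt_devFoot (k : ℤ) {t : ℝ} (ht : |t| < 2 * π / 3) :
    HasDerivAt (devFoot k) ((1 / (3 * cos (t / 2))) •
      (sin (t / 2) • devDirection t + root t • rot (devDirection t))) t := by
  have hC := half_lt_cos_half ht
  have hC0 : 0 < cos (t / 2) := by linarith
  have hr := root_sq ht.le
  have hr0 := root_pos ht
  have hy := sin_sq_add_cos_sq (t / 2)
  have hy2 : sin (t / 2) ^ 2 = 1 - cos (t / 2) ^ 2 := by linarith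
  refine hasDerivAt_plane ?_ ?_
  · have := (((hasDerivAt_angle ht).add (((hasDerivAt_sin_half t).const_mul 2).mul
      (hasDerivAt_root ht))).const_mul (2 * √3 / 9)).const_add ((k : ℝ) * (4 * π / (3 * √3)))
    refine this.congr_deriv ?_
    simp only [rot, devDirection, PiLp.smul_apply, PiLp.add_apply, PiLp.toLp_apply,
      Matrix.cons_val, smul_eq_mul]
    rw [sin_eq_half t]
    field_simp
    simp only [hr, hy2]
    ring
  · have := (((((hasDerivAt_cos_half t).pow 2).const_sub 1).const_mul 8).sub
      (((hasDerivAt_cos_half t).log hC0.ne').const_mul 2)).const_mul (√3 / 9)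
    refine this.congr_deriv ?_
    simp only [rot, devDirection, PiLp.smul_apply, PiLp.add_apply, PiLp.toLp_apply,
      Matrix.cons_val, smul_eq_mul]
    field_simp
    simp only [hr]
    ring

theorem inner_devDirection {t : ℝ} (ht : |t| ≤ 2 * π / 3) :
    ⟪devDirection t, devDirection t⟫ = 3 := by
  have hC := half_le_cos_half ht
  have hC0 : 0 < cos (t / 2) := by linarith
  have hr := root_sq ht
  have hy := sin_sq_add_cos_sq (t / 2)
  have hy2 : sin (t / 2) ^ 2 = 1 - cos (t / 2) ^ 2 := by linarith
  have h3 : (√3 : ℝ) ^ 2 = 3 := sq_sqrt (by norm_num)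
  rw [inner_plane]
  simp only [devDirection, PiLp.toLp_apply, Matrix.cons_val]
  field_simp
  simp only [hr, hy2, h3]
  ring

theorem sin_cos_joint : sin (2 * π / 3 / 2) = √3 / 2 ∧ cos (2 * π / 3 / 2) = 1 / 2 := by
  rw [show 2 * π / 3 / 2 = π / 3 by ring]
  exact ⟨sin_pi_div_three, cos_pi_div_three⟩

theorem angle_joint : angle (2 * π / 3) = π := by
  have h3 : √(3 : ℝ) ≠ 0 := by positivity
  obtain ⟨h1, h2⟩ := sin_cos_joint
  rw [angle, h1, h2, show 2 * (√3 / 2) / √3 = 1 by field_simp,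
    show √3 / 2 / (√3 * (1 / 2)) = 1 by field_simp, arcsin_one]
  ring

theorem angle_neg (t : ℝ) : angle (-t) = -angle t := by
  simp only [angle, neg_div, sin_neg, cos_neg, mul_neg, arcsin_neg]; ring

/-- Passing a joint, `angle` drops from π to −π. The translation 4π/(3√3) = (2√3/9)·2π compensates.
-/
theorem compatible_devFoot : Compatible devFoot where
  joint k := by
    have h1 := angle_joint
    have hr := root_joint
    ext i
    fin_cases i
    · simp only [devFoot, angle_neg, root_neg, h1, hr]
      simp
      field_simp
      rw [sq_sqrt (by norm_num)]
      ring
    · simp [devFoot, neg_div]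

theorem compatible_devDirection : Compatible (fun _ : ℤ => devDirection) where
  joint k := by
    have hr := root_joint
    ext i
    fin_cases i <;> simp [devDirection, root_neg, hr, neg_div]

/-- The development of the extended oloid. -/
def development (t m : ℝ) : Plane :=
  devFoot (pieceIndex t) (h t) + m • devDirection (h t)

theorem cos_half_ne_zero {t : ℝ} (ht : t ∈ Icc (-(2 * π / 3)) (2 * π / 3)) : cos (t / 2) ≠ 0 := by
  have := half_le_cos_half (abs_le_of_mem_Icc ht)
  positivity

theorem continuous_devDirection : Continuous fun t => devDirection (h t) := by
  refine compatible_devDirection.continuous fun k => ?_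
  have hne : ∀ t ∈ Icc (-(2 * π / 3)) (2 * π / 3), 9 * cos (t / 2) ^ 2 ≠ 0 := by
    intro t ht
    have := cos_half_ne_zero ht
    positivity
  have hr := continuous_root
  unfold devDirection
  refine (PiLp.continuous_toLp 2 _).comp_continuousOn (continuousOn_pi.2 fun i => ?_)
  fin_cases i <;> simp <;> fun_prop (disch := assumption)

theorem continuousOn_angle : ContinuousOn angle (Icc (-(2 * π / 3)) (2 * π / 3)) := by
  have hne : ∀ t ∈ Icc (-(2 * π / 3)) (2 * π / 3), √3 * cos (t / 2) ≠ 0 := by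
    intro t ht
    have := cos_half_ne_zero ht
    positivity
  have : ContinuousOn (fun t => sin (t / 2) / (√3 * cos (t / 2)))
    (Icc (-(2 * π / 3)) (2 * π / 3)) := by fun_prop (disch := assumption)
  exact (Continuous.continuousOn (by fun_prop)).add (continuous_arcsin.comp_continuousOn this)

theorem continuous_devFoot : Continuous fun t => devFoot (pieceIndex t) (h t) := by
  refine compatible_devFoot.continuous fun k => ?_
  have hne : ∀ t ∈ Icc (-(2 * π / 3)) (2 * π / 3), cos (t / 2) ≠ 0 := fun t => cos_half_ne_zero
  have hr := continuous_root
  have ha := continuousOn_angle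
  unfold devFoot
  refine (PiLp.continuous_toLp 2 _).comp_continuousOn (continuousOn_pi.2 fun i => ?_)
  fin_cases i <;> simp <;> fun_prop (disch := assumption)

theorem partialM_development (t m : ℝ) : partialM development t m = devDirection (h t) :=
  (hasDerivAt_line _ _ m).deriv

theorem hasDerivAt_development {t : ℝ} (ht : |h t| < 2 * π / 3) (m : ℝ) :
    HasDerivAt (fun τ => development τ m)
      ((sin (h t / 2) / (3 * cos (h t / 2))) • devDirection (h t) +
        (root (h t) / (3 * cos (h t / 2)) - m * (cos (h t) / (root (h t) * cos (h t / 2)))) •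
          rot (devDirection (h t))) t := by
  have h1 := hasDerivAt_piece (f := devFoot) ht (hasDerivAt_devFoot _ ht)
  have h2 := hasDerivAt_piece (f := fun _ => devDirection) ht (hasDerivAt_devDirection ht)
  refine (h1.add (h2.const_smul m)).congr_deriv ?_
  module

theorem inner_rot (u : Plane) : ⟪u, rot u⟫ = 0 := by
  rw [inner_plane]; simp [rot]; ring

theorem inner_rot_left (u : Plane) : ⟪rot u, u⟫ = 0 := by
  rw [real_inner_comm, inner_rot]

theorem inner_rot_rot (u : Plane) : ⟪rot u, rot u⟫ = ⟪u, u⟫ := by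
  simp only [inner_plane]; simp [rot]; ring

theorem area_add_rot (u : Plane) (a b : ℝ) : area u (a • u + b • rot u) = -(b * ⟪u, u⟫) := by
  rw [inner_plane]; simp [area, rot]; ring

theorem partialT_development {t : ℝ} (ht : |h t| < 2 * π / 3) (m : ℝ) :
    partialT development t m = (sin (h t / 2) / (3 * cos (h t / 2))) • devDirection (h t) +
        (root (h t) / (3 * cos (h t / 2)) - m * (cos (h t) / (root (h t) * cos (h t / 2)))) •
          rot (devDirection (h t)) :=
  (hasDerivAt_development ht m).deriv

theorem angle_zero : angle 0 = 0 := by simp [angle]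

theorem root_zero : root 0 = √3 := by simp [root]; norm_num

theorem devDirection_zero : devDirection 0 = !₂[0, √3] := by
  ext i
  fin_cases i
  · simp [devDirection]
  · simp [devDirection]; norm_num

theorem isDevelopment_development : IsDevelopment development where
  continuous := (continuous_devFoot.comp continuous_fst).add
    (continuous_snd.smul (continuous_devDirection.comp continuous_fst))
  isometric_on_lines t m m' := by
    rw [dist_surface, development, development, dist_add_left, dist_eq_norm, ← sub_smul, norm_smul,
      norm_eq_sqrt_real_inner (devDirection _), inner_devDirection (abs_h_le t), norm_eq_abs,
      mul_comm]
  differentiable t ht m := (hasDerivAt_development ht m).differentiableAt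
  first_form t ht m := by
    have hb := inner_devDirection ht.le
    have hC := half_lt_cos_half ht
    rw [partialM_development, partialM_surface, partialT_development ht, partialT_surface ht]
    refine ⟨?_, ?_, ?_⟩
    · rw [hb, inner_direction _ ht.le]
    · rw [inner_direction_velocity _ _ ht, inner_add_right, inner_smul_right, inner_smul_right, hb,
        inner_rot]
      field_simp
      ring
    · rw [inner_velocity _ _ ht]
      simp only [inner_add_right, inner_add_left, inner_smul_right, inner_smul_left, hb,
        inner_rot, inner_rot_left, inner_rot_rot]
      simp
      field_simp
  oriented := by
    refine ⟨normal, isUnitNormal_normal, fun t ht m => ?_⟩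
    rw [partialM_development, partialM_surface, partialT_development ht, partialT_surface ht,
      normal, volume3_normalPiece _ _ ht, area_add_rot, inner_devDirection ht.le]
    ring
  eta_axis m := by
    rw [dist_surface, development, pieceIndex_zero, h_zero, devDirection_zero]
    ext i
    fin_cases i <;> simp [devFoot, angle_zero]
  xi_axis := by
    rw [partialT_development abs_h_zero_lt, h_zero, devDirection_zero]
    simp [rot, root_zero]

/-! ### Uniqueness of the development. -/

theorem IsUnitNormal.inner_normal {N : ℝ → Space} (hN : IsUnitNormal N) {t : ℝ}
    (ht : |h t| < 2 * π / 3) :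
    ⟪N t, normal t⟫ ^ 2 = 1 ∧ N t = ⟪N t, normal t⟫ • normal t := by
  have hC := half_lt_cos_half ht
  have hC0 : 0 < cos (h t / 2) := by linarith
  have hc := one_add_cos_pos ht.le
  have hr := root_sq ht.le
  have hr0 := root_pos ht
  have hr1 : root (h t) ^ 2 = 1 + 2 * cos (h t) := by rw [hr, cos_eq_half (h t)]; ring
  have he := neg_one_zpow_sq (pieceIndex t)
  have hs := sin_sq_add_cos_sq (h t)
  obtain ⟨h1, h2⟩ := hN.orthogonal t ht 0
  have h3 : ⟪N t, N t⟫ = 1 := by rw [real_inner_self_eq_norm_sq, hN.norm_eq_one]; norm_num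
  rw [partialM_surface] at h1
  rw [partialT_surface ht] at h2
  rw [inner_space] at h1 h2 h3
  simp only [direction, velocity, PiLp.toLp_apply, Matrix.cons_val] at h1 h2
  set e : ℝ := (-1) ^ pieceIndex t with hedef
  set s := sin (h t)
  set c := cos (h t)
  set C := cos (h t / 2)
  set W := root (h t)
  have hs2 : s ^ 2 = 1 - c ^ 2 := by linarith
  -- Orthogonality to the horizontal velocity (ec, s, 0) of the foot leaves (N₀, N₁) = β(−es, c).
  -- Orthogonality to the direction then gives N₂ = eWβ, and unit length gives (2Cβ)² = 1.
  obtain ⟨β, hβ⟩ : ∃ β, β = -s * e * N t 0 + c * N t 1 := ⟨_, rfl⟩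
  have hx : N t 0 = -e * s * β := by
    rw [hβ]; linear_combination e * c * h2 - N t 0 * (s ^ 2 + c ^ 2) * he - N t 0 * hs
  have hy : N t 1 = c * β := by
    rw [hβ]; linear_combination s * h2 - N t 1 * hs
  have hz : N t 2 = e * W * β := by
    have h4 : W * (N t 2 - e * W * β) = 0 := by
      rw [hx, hy] at h1
      field_simp at h1
      linear_combination (exp := 1) -e * h1 + (β * s ^ 2 * e * (1 + c) - N t 2 * W) * he +
        β * e * (1 + c) * hs - e * β * hr1
    rcases mul_eq_zero.1 h4 with h5 | h5 <;> linarith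
  have hin : ⟪N t, normal t⟫ = 2 * C * β := by
    rw [inner_space]
    simp only [normal, normalPiece, PiLp.toLp_apply, Matrix.cons_val, hx, hy, hz]
    rw [← hedef]
    change -e * s * β * -(e * (s / (2 * C))) + c * β * (c / (2 * C)) + e * W * β * (e * (W / (2 * C))) = _
    field_simp
    rw [he, hr, hs2]
    ring
  refine ⟨?_, ?_⟩
  · rw [hx, hy, hz] at h3
    rw [hin]
    linear_combination h3 - β ^ 2 * (s ^ 2 + W ^ 2) * he - β ^ 2 * hs - β ^ 2 * hr
  · rw [hin]
    ext i
    fin_cases i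
    · change N t 0 = 2 * C * β * -(e * (s / (2 * C)))
      rw [hx]; field_simp
    · change N t 1 = 2 * C * β * (c / (2 * C))
      rw [hy]; field_simp
    · change N t 2 = 2 * C * β * (e * (W / (2 * C)))
      rw [hz]; field_simp

/-- The inner product with `normal` is continuous and has square 1 on a dense set, hence everywhere.
Since ℝ is connected, it is constantly 1 or −1. -/
theorem IsUnitNormal.eq_or_eq_neg {N : ℝ → Space} (hN : IsUnitNormal N) :
    (∀ t, |h t| < 2 * π / 3 → N t = normal t) ∨ (∀ t, |h t| < 2 * π / 3 → N t = -normal t) := by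
  have hc : Continuous fun t => ⟪N t, normal t⟫ := hN.continuous.inner continuous_normal
  have hsq : (fun t => ⟪N t, normal t⟫ ^ 2) = fun _ => (1 : ℝ) :=
    (hc.pow 2).ext_on dense_interior continuous_const fun t ht => (hN.inner_normal ht).1
  have := isPreconnected_univ.eq_or_eq_neg_of_sq_eq (f := fun t => ⟪N t, normal t⟫)
    (g := fun _ => (1 : ℝ)) hc.continuousOn continuousOn_const
    (fun t _ => by simpa using congrFun hsq t) (fun _ => one_ne_zero)
  rcases this with h1 | h1
  · refine Or.inl fun t ht => ?_
    rw [(hN.inner_normal ht).2, show ⟪N t, normal t⟫ = 1 from h1 (mem_univ t), one_smul]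
  · refine Or.inr fun t ht => ?_
    rw [(hN.inner_normal ht).2, show ⟪N t, normal t⟫ = -1 from h1 (mem_univ t), neg_one_smul]

theorem volume3_neg (n u v : Space) : volume3 (-n) u v = -volume3 n u v := by
  simp [volume3]; ring

/-- The vector u and its rotation by a right angle form an orthogonal basis, and the hypotheses
compare coordinates in it. -/
theorem area_self_inner {u v w : Plane} (hu : ⟪u, u⟫ = 3) (h1 : ⟪u, v⟫ = ⟪u, w⟫)
    (h2 : area u v = area u w) : v = w := by
  rw [inner_plane] at *
  rw [inner_plane] at h1
  simp only [area] at h2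
  ext i
  fin_cases i
  · change v 0 = w 0
    linear_combination (u 0 * h1 - u 1 * h2 - (v 0 - w 0) * hu) / 3
  · change v 1 = w 1
    linear_combination (u 1 * h1 + u 0 * h2 - (v 1 - w 1) * hu) / 3

namespace IsDevelopment

variable {D : ℝ → ℝ → Plane}

theorem eq_add_smul (hD : IsDevelopment D) (t m : ℝ) :
    D t m = D t 0 + m • (D t 1 - D t 0) := by
  have h3 : 0 < √(3 : ℝ) := by positivity
  -- The parameter m runs with speed √3. After rescaling, the line is an isometric map into a
  -- strictly convex space, hence affine.
  have hi : Isometry fun x : ℝ => D t (x / √3) := by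
    refine Isometry.of_dist_eq fun x y => ?_
    rw [hD.isometric_on_lines, dist_surface, ← sub_div, abs_div, abs_of_pos h3, Real.dist_eq]
    field_simp
  have := hi.affineIsometryOfStrictConvexSpace.toAffineMap.apply_lineMap 0 √3 m
  simp [AffineMap.lineMap_apply, h3.ne'] at this
  rw [this, add_comm]

theorem partialM_eq (hD : IsDevelopment D) (t m : ℝ) : partialM D t m = D t 1 - D t 0 := by
  rw [partialM, show (fun μ => D t μ) = fun μ => D t 0 + μ • (D t 1 - D t 0) from
    funext (hD.eq_add_smul t)]
  exact (hasDerivAt_line _ _ m).deriv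

theorem inner_self (hD : IsDevelopment D) (t : ℝ) : ⟪D t 1 - D t 0, D t 1 - D t 0⟫ = 3 := by
  rw [real_inner_self_eq_norm_sq, ← dist_eq_norm, hD.isometric_on_lines, dist_surface]
  norm_num

theorem inner_partialT (hD : IsDevelopment D) {t : ℝ} (ht : |h t| < 2 * π / 3) (m : ℝ) :
    ⟪D t 1 - D t 0, partialT D t m⟫ = sin (h t / 2) / cos (h t / 2) := by
  have := (hD.first_form t ht m).2.1
  rwa [hD.partialM_eq, partialM_surface, partialT_surface ht,
    inner_direction_velocity _ _ ht] at this

theorem area_partialT (hD : IsDevelopment D) {t : ℝ} (ht : |h t| < 2 * π / 3) (m : ℝ) :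
    area (D t 1 - D t 0) (partialT D t m) =
      -(3 * (root (h t) / (3 * cos (h t / 2)) -
        m * (cos (h t) / (root (h t) * cos (h t / 2))))) := by
  obtain ⟨N, hN, hv⟩ := hD.oriented
  simp only [hD.partialM_eq, partialM_surface] at hv
  -- The opposite normal would force the ξ-component of the t-derivative at the origin to be −1.
  have key : ∀ t, |h t| < 2 * π / 3 → N t = normal t := by
    refine hN.eq_or_eq_neg.resolve_right fun hneg => ?_
    have h1 := hv 0 abs_h_zero_lt 0
    rw [hneg 0 abs_h_zero_lt, volume3_neg, partialT_surface abs_h_zero_lt, normal,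
      volume3_normalPiece _ _ abs_h_zero_lt, h_zero, root_zero, hD.eta_axis, hD.eta_axis,
      dist_surface] at h1
    have h2 := hD.xi_axis
    simp [area] at h1
    have : 0 < √3 := by positivity
    nlinarith
  rw [hv t ht m, key t ht, partialT_surface ht, normal, volume3_normalPiece _ _ ht]

theorem hasDerivAt (hD : IsDevelopment D) {t : ℝ} (ht : |h t| < 2 * π / 3) (m : ℝ) :
    HasDerivAt (fun τ => D τ m) (partialT D t m) t :=
  (hD.differentiable t ht m).hasDerivAt

theorem continuous_line (hD : IsDevelopment D) (m : ℝ) : Continuous fun t => D t m :=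
  hD.continuous.comp (continuous_id.prodMk continuous_const)

/-- Both directions turn at the same rate, so their inner product keeps its initial value 3, which
is also both squared norms. The difference then has norm zero. -/
theorem direction_eq {D' : ℝ → ℝ → Plane} (hD : IsDevelopment D) (hD' : IsDevelopment D') (t : ℝ) :
    D t 1 - D t 0 = D' t 1 - D' t 0 := by
  have hc : ⟪D t 1 - D t 0, D' t 1 - D' t 0⟫ = 3 := by
    have := eq_of_hasDerivAt_zero (f := fun t => ⟪D t 1 - D t 0, D' t 1 - D' t 0⟫)
      (((hD.continuous_line 1).sub (hD.continuous_line 0)).inner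
        ((hD'.continuous_line 1).sub (hD'.continuous_line 0))) ?_ t
    · rw [this, hD.eta_axis, hD.eta_axis, ← hD'.eta_axis, ← hD'.eta_axis, hD'.inner_self]
    intro t ht
    have h1 := ((hD.hasDerivAt ht 1).sub (hD.hasDerivAt ht 0)).inner ℝ
      ((hD'.hasDerivAt ht 1).sub (hD'.hasDerivAt ht 0))
    refine h1.congr_deriv ?_
    simp only [Pi.sub_apply]
    have i0 := hD.inner_partialT ht 0
    have i1 := hD.inner_partialT ht 1
    have j0 := hD'.inner_partialT ht 0
    have j1 := hD'.inner_partialT ht 1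
    have a0 := hD.area_partialT ht 0
    have a1 := hD.area_partialT ht 1
    have b0 := hD'.area_partialT ht 0
    have b1 := hD'.area_partialT ht 1
    have n := hD.inner_self t
    have n' := hD'.inner_self t
    set r := cos (h t) / (root (h t) * cos (h t / 2))
    -- Subtracting the velocities at m = 0 and m = 1 isolates the rotation of the direction.
    have hu : partialT D t 1 - partialT D t 0 = (-r) • rot (D t 1 - D t 0) := by
      refine area_self_inner n ?_ ?_
      · rw [inner_sub_right, i0, i1, inner_smul_right, inner_rot]; ring
      · rw [← zero_add ((-r) • _), ← zero_smul ℝ (D t 1 - D t 0), area_add_rot, n]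
        simp only [area, PiLp.sub_apply] at *
        linarith
    have hu' : partialT D' t 1 - partialT D' t 0 = (-r) • rot (D' t 1 - D' t 0) := by
      refine area_self_inner n' ?_ ?_
      · rw [inner_sub_right, j0, j1, inner_smul_right, inner_rot]; ring
      · rw [← zero_add ((-r) • _), ← zero_smul ℝ (D' t 1 - D' t 0), area_add_rot, n']
        simp only [area, PiLp.sub_apply] at *
        linarith
    rw [hu, hu', inner_plane, inner_plane]
    simp [rot]
    ring
  have := hD.inner_self t
  have h' := hD'.inner_self t
  generalize D t 1 - D t 0 = u at *
  generalize D' t 1 - D' t 0 = u' at *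
  rw [← sub_eq_zero, ← inner_self_eq_zero (𝕜 := ℝ), inner_sub_left, inner_sub_right,
    inner_sub_right, this, h', real_inner_comm u u', hc]
  norm_num

theorem unique {D' : ℝ → ℝ → Plane} (hD : IsDevelopment D) (hD' : IsDevelopment D') : D = D' := by
  have foot : ∀ t, D t 0 = D' t 0 := by
    intro t
    ext i
    have hsub : ∀ t, |h t| < 2 * π / 3 → HasDerivAt (fun τ => D τ 0 - D' τ 0) 0 t := by
      intro t ht
      refine ((hD.hasDerivAt ht 0).sub (hD'.hasDerivAt ht 0)).congr_deriv ?_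
      rw [sub_eq_zero]
      refine area_self_inner (hD.inner_self t) ?_ ?_
      · rw [hD.inner_partialT ht, hD.direction_eq hD', hD'.inner_partialT ht]
      · rw [hD.area_partialT ht, hD.direction_eq hD', hD'.area_partialT ht]
    have := eq_of_hasDerivAt_zero (f := fun t => (D t 0 - D' t 0) i)
      ((PiLp.continuous_apply 2 _ i).comp ((hD.continuous_line 0).sub (hD'.continuous_line 0)))
      (fun t ht => hasDerivAt_apply (hsub t ht) i) t
    rw [hD.eta_axis, ← hD'.eta_axis, sub_self] at this
    simpa [sub_eq_zero] using this
  funext t m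
  rw [hD.eq_add_smul, hD'.eq_add_smul t m, hD.direction_eq hD', foot]

end IsDevelopment

/-! ### The edge of regression. -/

theorem surface_one_sub (t : ℝ) :
    surface t 1 - surface t 0 = direction (pieceIndex t) (h t) := by
  rw [surface_eq_add t 1]; simp

theorem mem_edgeOfRegression_iff {t : ℝ} (ht : |h t| < 2 * π / 3) (m : ℝ) :
    (t, m) ∈ edgeOfRegression ↔ 3 * m * cos (h t) = 1 + 2 * cos (h t) := by
  have hC := half_lt_cos_half ht
  have hC0 : 0 < cos (h t / 2) := by linarith
  have hr0 := root_pos ht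
  have hr : root (h t) ^ 2 = 1 + 2 * cos (h t) := by rw [root_sq ht.le, cos_eq_half (h t)]; ring
  have hv := volume3_normalPiece m (pieceIndex t) ht
  have hz : root (h t) / (3 * cos (h t / 2)) - m * (cos (h t) / (root (h t) * cos (h t / 2))) = 0 ↔
      3 * m * cos (h t) = 1 + 2 * cos (h t) := by
    rw [← hr]
    field_simp
    rw [mul_zero, sub_eq_zero, eq_comm]
  rw [← hz]
  constructor
  · rintro ⟨v, hd, r, hr⟩
    have he : v = velocity m (pieceIndex t) (h t) :=
      (uniqueDiffWithinAt_Ici t).eq_deriv _ hd (hasDerivAt_surface ht m).hasDerivWithinAt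
    rw [← he, hr] at hv
    simp only [surface_one_sub] at hv
    simp only [volume3, PiLp.smul_apply, smul_eq_mul] at hv
    linarith
  · intro h0
    -- The factor is ⟨d, v⟩/⟨d, d⟩. With vanishing transverse part, Cauchy–Schwarz is an equality
    -- and v is this multiple of d.
    refine ⟨_, (hasDerivAt_surface ht m).hasDerivWithinAt, sin (h t / 2) / cos (h t / 2) / 3, ?_⟩
    have h1 := inner_velocity m (pieceIndex t) ht
    have h2 := inner_direction_velocity m (pieceIndex t) ht
    have h3 := inner_direction (pieceIndex t) ht.le
    simp only [surface_one_sub]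
    rw [h0] at h1
    generalize velocity m (pieceIndex t) (h t) = v at *
    generalize direction (pieceIndex t) (h t) = d at *
    rw [← sub_eq_zero, ← inner_self_eq_zero (𝕜 := ℝ)]
    simp only [inner_sub_left, inner_sub_right, real_inner_smul_left, real_inner_smul_right]
    rw [h1, real_inner_comm d v, h2, h3]
    ring

/-- The joint is taken as the left end of the piece on its right, where the right-hand derivative is
computed. -/
theorem exists_piece_joint {t : ℝ} (ht : ¬ |h t| < 2 * π / 3) :
    ∃ k : ℤ, t - k * (4 * π / 3) = -(2 * π / 3) := by
  obtain ⟨k, h1, h2⟩ := exists_piece_right t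
  refine ⟨k, h1.eq_of_not_lt' fun h3 => ht ?_⟩
  have h4 : |t - k * (4 * π / 3)| < 2 * π / 3 := abs_lt.2 ⟨h3, h2⟩
  rwa [h_eq, pieceIndex_eq h4]

theorem surface_joint {t : ℝ} {k : ℤ} (hk : t - k * (4 * π / 3) = -(2 * π / 3)) (m : ℝ) :
    ∀ τ ∈ Icc t (t + 4 * π / 3), surface τ m = surfacePiece m k (τ - k * (4 * π / 3)) := by
  rintro τ ⟨h1, h2⟩
  rw [surface_eq]
  exact (compatible_surfacePiece m).eq_piece (abs_le.2 ⟨by linarith, by linarith⟩)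

/-- For m = 0 the square root drops out, so the joints need not be excluded. -/
theorem hasDerivAt_surfacePiece_zero (k : ℤ) (t : ℝ) :
    HasDerivAt (surfacePiece 0 k) (velocity 0 k t) t := by
  refine hasDerivAt_space ?_ ?_ ?_
  · simpa [surfacePiece, omega, alpha, beta, velocity] using
      (hasDerivAt_sin t).const_mul ((-1 : ℝ) ^ k)
  · simpa [surfacePiece, omega, alpha, beta, velocity] using
      (hasDerivAt_cos t).const_sub (-1 / 2)
  · simpa [surfacePiece, omega, alpha, beta, velocity] using hasDerivAt_const t (0 : ℝ)

theorem sin_joint : sin (2 * π / 3) = √3 / 2 := by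
  rw [show 2 * π / 3 = π - π / 3 by ring, sin_pi_sub, sin_pi_div_three]

/-- The third coordinate behaves like m times a square root at its zero. If it were differentiable,
the square of (1 + cos) times it would have derivative 0, whereas that square is m²(1 + 2 cos), with
derivative √3 m². -/
theorem mem_edgeOfRegression_joint {t : ℝ} (ht : ¬ |h t| < 2 * π / 3) (m : ℝ) :
    (t, m) ∈ edgeOfRegression ↔ m = 0 := by
  obtain ⟨k, hk⟩ := exists_piece_joint ht
  have hπ := pi_pos
  have hs := sin_joint
  have hc := cos_joint
  have hr := root_joint
  have h3 : 0 < √(3 : ℝ) := by positivity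
  have hmem : t ∈ Icc t (t + 4 * π / 3) := ⟨le_rfl, by linarith [show 0 < 4 * π / 3 by positivity]⟩
  have hnhds : Icc t (t + 4 * π / 3) ∈ 𝓝[≥] t :=
    Icc_mem_nhdsGE (by linarith [show 0 < 4 * π / 3 by positivity])
  have hev : ∀ m, (fun τ => surface τ m) =ᶠ[𝓝[≥] t]
      fun τ => surfacePiece m k (τ - k * (4 * π / 3)) :=
    fun m => mem_of_superset hnhds (surface_joint hk m)
  constructor
  · rintro ⟨v, hd, -⟩
    have hd' := (hd.congr_of_eventuallyEq (hev m).symm (surface_joint hk m t hmem).symm)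
    have h2 : HasDerivWithinAt (fun τ => surfacePiece m k (τ - k * (4 * π / 3)) 2) (v 2) (Ici t) t :=
      (EuclideanSpace.proj (𝕜 := ℝ) (2 : Fin 3)).hasFDerivAt.comp_hasDerivWithinAt t hd'
    have h4 : HasDerivAt (fun τ : ℝ => 1 + cos (τ - k * (4 * π / 3)))
        (-sin (t - k * (4 * π / 3))) t :=
      HasDerivAt.comp_sub_const (f := fun x => 1 + cos x) t _ ((hasDerivAt_cos _).const_add 1)
    have h5 := ((h2.mul h4.hasDerivWithinAt).pow 2)
    have h6 : HasDerivAt (fun τ : ℝ => m ^ 2 * (1 + 2 * cos (τ - k * (4 * π / 3))))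
        (m ^ 2 * (2 * -sin (t - k * (4 * π / 3)))) t :=
      HasDerivAt.comp_sub_const (f := fun x => m ^ 2 * (1 + 2 * cos x)) t _
        ((((hasDerivAt_cos _).const_mul 2).const_add 1).const_mul _)
    have heq : ∀ τ ∈ Icc t (t + 4 * π / 3), m ^ 2 * (1 + 2 * cos (τ - k * (4 * π / 3))) =
        (surfacePiece m k (τ - k * (4 * π / 3)) 2 * (1 + cos (τ - k * (4 * π / 3)))) ^ 2 := by
      rintro τ ⟨g1, g2⟩
      have g3 : |τ - k * (4 * π / 3)| ≤ 2 * π / 3 := abs_le.2 ⟨by linarith, by linarith⟩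
      have g4 := one_add_cos_pos g3
      have g5 := root_sq g3
      have g6 := neg_one_zpow_sq k
      have g7 := cos_eq_half (τ - k * (4 * π / 3))
      rw [surfacePiece_apply_two]
      generalize τ - k * (4 * π / 3) = x at *
      have g8 : root x ^ 2 = 1 + 2 * cos x := by rw [g5, g7]; ring
      field_simp
      rw [g6, g8]
      ring
    have h7 := h5.congr_of_eventuallyEq (mem_of_superset hnhds heq) (heq t hmem)
    have h8 := (uniqueDiffWithinAt_Ici t).eq_deriv _ h6.hasDerivWithinAt h7
    simp [surfacePiece_apply_two, hk, root_neg, hr, hs, h3.ne'] at h8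
    exact h8
  · rintro rfl
    have h1 : HasDerivAt (fun τ => surfacePiece 0 k (τ - k * (4 * π / 3)))
        (velocity 0 k (-(2 * π / 3))) t := by
      rw [← hk]
      exact HasDerivAt.comp_sub_const t _ (hasDerivAt_surfacePiece_zero k _)
    -- At a joint the generating line is tangent to the first circle. Comparing (−e/2, −√3/2, 0)
    -- with (e√3/2, 3/2, 0), where e = ±1, gives the ratio −1/√3.
    refine ⟨_, h1.hasDerivWithinAt.congr_of_eventuallyEq (hev 0) (surface_joint hk 0 t hmem),
      -1 / √3, ?_⟩
    simp only
    rw [surface_joint hk 1 t hmem, surface_joint hk 0 t hmem, hk, surfacePiece_eq 1]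
    ext i
    fin_cases i
    · simp [velocity, direction, hs, hc]; field_simp
    · simp [velocity, direction, hs, hc]; field_simp; rw [sq_sqrt (by norm_num)]; norm_num
    · simp [velocity, direction, root_neg, hr]

/-! ### Agreement with the closed formulas. -/

theorem sqrt_one_add_cos {t : ℝ} (ht : |t| ≤ 2 * π / 3) : √(1 + cos t) = √2 * cos (t / 2) := by
  have := half_le_cos_half ht
  rw [cos_eq_half t, show 1 + (2 * cos (t / 2) ^ 2 - 1) = 2 * cos (t / 2) ^ 2 by ring,
    sqrt_mul (by norm_num), sqrt_sq (by linarith)]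

theorem cos_angle {t : ℝ} (ht : |t| ≤ 2 * π / 3) : cos (angle t) = cos t / cos (t / 2) := by
  have hC := half_le_cos_half ht
  have hC0 : 0 < cos (t / 2) := by linarith
  have hr := root_sq ht
  have hr0 : 0 ≤ root t := sqrt_nonneg _
  have hy := sin_sq_add_cos_sq (t / 2)
  have h3 : (√3 : ℝ) ^ 2 = 3 := sq_sqrt (by norm_num)
  have h30 : 0 < √(3 : ℝ) := by positivity
  have e1 : 1 - (2 * sin (t / 2) / √3) ^ 2 = (root t / √3) ^ 2 := by
    field_simp; rw [hr, h3]; linarith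
  have e2 : 1 - (sin (t / 2) / (√3 * cos (t / 2))) ^ 2 = (root t / (√3 * cos (t / 2))) ^ 2 := by
    field_simp; rw [hr, h3]; linarith
  have f1 : 0 ≤ root t / √3 := by positivity
  have f2 : 0 ≤ root t / (√3 * cos (t / 2)) := by positivity
  have g1 := abs_le_one_iff_mul_self_le_one.2
    (show 2 * sin (t / 2) / √3 * (2 * sin (t / 2) / √3) ≤ 1 by nlinarith [sq_nonneg (root t / √3)])
  have g2 := abs_le_one_iff_mul_self_le_one.2
    (show sin (t / 2) / (√3 * cos (t / 2)) * (sin (t / 2) / (√3 * cos (t / 2))) ≤ 1 by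
      nlinarith [sq_nonneg (root t / (√3 * cos (t / 2)))])
  rw [abs_le] at g1 g2
  rw [angle, cos_add, cos_arcsin, cos_arcsin, e1, e2, sqrt_sq f1, sqrt_sq f2,
    sin_arcsin g1.1 g1.2, sin_arcsin g2.1 g2.2, cos_eq_half t]
  field_simp
  rw [hr, h3]
  linarith

/-- For t ≥ 0 both arcsines lie in [0, π/2], so `angle t` lies in [0, π], where arccos inverts cos.
-/
theorem arccos_eq_angle {t : ℝ} (h0 : 0 ≤ t) (ht : t ≤ 2 * π / 3) :
    arccos (√2 * cos t / √(1 + cos t)) = angle t := by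
  have ht' : |t| ≤ 2 * π / 3 := by rwa [abs_of_nonneg h0]
  have hC := half_le_cos_half ht'
  have hC0 : 0 < cos (t / 2) := by linarith
  have hy : 0 ≤ sin (t / 2) := sin_nonneg_of_nonneg_of_le_pi (by linarith) (by linarith [pi_pos])
  have e : √2 * cos t / √(1 + cos t) = cos (angle t) := by
    rw [cos_angle ht', sqrt_one_add_cos ht']
    field_simp
  rw [e, arccos_cos]
  · exact add_nonneg (arcsin_nonneg.2 (by positivity)) (arcsin_nonneg.2 (by positivity))
  · have h1 := arcsin_le_pi_div_two (2 * sin (t / 2) / √3)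
    have h2 := arcsin_le_pi_div_two (sin (t / 2) / (√3 * cos (t / 2)))
    rw [angle]; linarith

theorem gTilde₁_of_nonneg {t : ℝ} (h0 : 0 ≤ t) (ht : t ≤ 2 * π / 3) :
    gTilde₁ t = 2 * √3 / 9 * (angle t -
      (2 + 2 * cos t - cos t ^ 2) * root t * sin (t / 2) / (3 * cos t * cos (t / 2) ^ 2)) := by
  have ht' : |t| ≤ 2 * π / 3 := by rwa [abs_of_nonneg h0]
  have hC := half_le_cos_half ht'
  have hC0 : 0 < cos (t / 2) := by linarith
  have hc := one_add_cos_pos ht'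
  have hs : 0 ≤ sin t := sin_nonneg_of_nonneg_of_le_pi h0 (by linarith [pi_pos])
  have hp : (1 + cos t) ^ (3 / 2 : ℝ) = 2 * √2 * cos (t / 2) ^ 3 := by
    rw [show (3 / 2 : ℝ) = 1 + 1 / 2 by norm_num, rpow_add hc, rpow_one, ← sqrt_eq_rpow,
      sqrt_one_add_cos ht', cos_eq_half t]
    ring
  rw [gTilde₁, arccos_eq_angle h0 ht, hp, abs_of_nonneg hs, sqrt_mul (by norm_num),
    sin_eq_half t, ← root]
  congr 2
  have h2 : (0 : ℝ) < √2 := by positivity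
  field_simp

theorem gTilde₁_neg (t : ℝ) : gTilde₁ (-t) = gTilde₁ t := by
  simp [gTilde₁]

/-- The right side is odd and `gTilde₁` is even, so the sign factor reduces the claim to t ≥ 0. -/
theorem sign_mul_gTilde₁ {t : ℝ} (ht : |t| ≤ 2 * π / 3) :
    Real.sign t * gTilde₁ t = 2 * √3 / 9 * (angle t -
      (2 + 2 * cos t - cos t ^ 2) * root t * sin (t / 2) / (3 * cos t * cos (t / 2) ^ 2)) := by
  rw [abs_le] at ht
  rcases lt_trichotomy t 0 with h0 | rfl | h0
  · rw [Real.sign_of_neg h0, ← gTilde₁_neg, gTilde₁_of_nonneg (by linarith) (by linarith),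
      angle_neg, root_neg, neg_div, sin_neg, cos_neg, cos_neg]
    ring
  · simp [angle_zero]
  · rw [Real.sign_of_pos h0, gTilde₁_of_nonneg h0.le ht.2, one_mul]

theorem development_eq_gStar {t : ℝ} (hc : cos (h t) ≠ 0) :
    development t ((1 + 2 * cos (h t)) / (3 * cos (h t))) = gStar t := by
  have ht := abs_h_le t
  have hC := half_le_cos_half ht
  have hC0 : 0 < cos (h t / 2) := by linarith
  ext i
  fin_cases i
  · change (pieceIndex t * (4 * π / (3 * √3)) + 2 * √3 / 9 *
      (angle (h t) + 2 * sin (h t / 2) * root (h t))) + _ * -(√3 * (2 * sin (h t / 2) * root (h t) *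
      (1 + 2 * cos (h t / 2) ^ 2) / (9 * cos (h t / 2) ^ 2))) =
      pieceIndex t * (4 * π / (3 * √3)) + Real.sign (h t) * gTilde₁ (h t)
    rw [sign_mul_gTilde₁ ht, add_assoc]
    congr 1
    have hh := cos_eq_half (h t)
    generalize cos (h t) = c at *
    have hC2 : cos (h t / 2) ^ 2 = (1 + c) / 2 := by linarith
    rw [hC2]
    have h1 : 1 + c ≠ 0 := by
      rw [hh, add_sub_cancel]; positivity
    field_simp
    ring
  · change √3 / 9 * (8 * (1 - cos (h t / 2) ^ 2) - 2 * log (cos (h t / 2))) + _ *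
      (√3 * ((8 * cos (h t / 2) ^ 4 - cos (h t / 2) ^ 2 + 2) / (9 * cos (h t / 2) ^ 2))) =
      √3 / 9 * (log (2 / (1 + cos (h t))) + _)
    have hh := cos_eq_half (h t)
    -- Since 1 + c = 2C², the argument of the logarithm is C⁻².
    have hlog : log (2 / (1 + cos (h t))) = -(2 * log (cos (h t / 2))) := by
      rw [hh, show 2 / (1 + (2 * cos (h t / 2) ^ 2 - 1)) = (cos (h t / 2) ^ 2)⁻¹ by field_simp; ring,
        log_inv, log_pow]
      norm_num
    rw [hlog]
    generalize cos (h t) = c at *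
    have hC2 : cos (h t / 2) ^ 2 = (1 + c) / 2 := by linarith
    have hC4 : cos (h t / 2) ^ 4 = ((1 + c) / 2) ^ 2 := by rw [← hC2]; ring
    rw [hC2, hC4]
    have h1 : 1 + c ≠ 0 := by
      rw [hh, add_sub_cancel]; positivity
    field_simp
    ring

theorem mem_edgeOfRegression_iff_eq {t : ℝ} (hc : cos (h t) ≠ 0) (m : ℝ) :
    (t, m) ∈ edgeOfRegression ↔ m = (1 + 2 * cos (h t)) / (3 * cos (h t)) := by
  by_cases ht : |h t| < 2 * π / 3
  · rw [mem_edgeOfRegression_iff ht, eq_div_iff (by positivity)]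
    constructor <;> intro h1 <;> linarith
  -- At a joint 1 + 2 cos = 0, so the interior formula also gives m = 0.
  · rw [mem_edgeOfRegression_joint ht, ← cos_abs, le_antisymm (abs_h_le t) (not_lt.1 ht), cos_joint]
    norm_num

theorem not_mem_edgeOfRegression {t : ℝ} (hc : cos (h t) = 0) (m : ℝ) :
    (t, m) ∉ edgeOfRegression := by
  have ht : |h t| < 2 * π / 3 := by
    refine lt_of_le_of_ne (abs_h_le t) fun h1 => ?_
    rw [← cos_abs, h1, cos_joint] at hc
    norm_num at hc
  rw [mem_edgeOfRegression_iff ht, hc]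
  norm_num

end Oloid

end

theorem mainTheorem7 :
    (∃! D : ℝ → ℝ → Oloid.Plane, Oloid.IsDevelopment D) ∧
    ∀ D : ℝ → ℝ → Oloid.Plane, Oloid.IsDevelopment D →
      (∀ t : ℝ, Real.cos (Oloid.h t) ≠ 0 →
        ∃ m : ℝ, (∀ m' : ℝ, (t, m') ∈ Oloid.edgeOfRegression ↔ m' = m) ∧
          D t m = Oloid.gStar t) ∧
      (∀ t : ℝ, Real.cos (Oloid.h t) = 0 → ∀ m : ℝ, (t, m) ∉ Oloid.edgeOfRegression) ∧
      {P : Oloid.Plane | ∃ t m : ℝ, (t, m) ∈ Oloid.edgeOfRegression ∧ P = D t m} =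
        {P : Oloid.Plane | ∃ t : ℝ, Real.cos (Oloid.h t) ≠ 0 ∧ P = Oloid.gStar t} := by

  refine ⟨⟨Oloid.development, Oloid.isDevelopment_development,
    fun D hD => hD.unique Oloid.isDevelopment_development⟩, fun D hD => ?_⟩
  obtain rfl := hD.unique Oloid.isDevelopment_development
  refine ⟨fun t hc => ⟨_, Oloid.mem_edgeOfRegression_iff_eq hc, Oloid.development_eq_gStar hc⟩,
    fun t => Oloid.not_mem_edgeOfRegression, ?_⟩
  ext P
  constructor
  · rintro ⟨t, m, hm, rfl⟩
    have hc : Real.cos (Oloid.h t) ≠ 0 := fun hc => Oloid.not_mem_edgeOfRegression hc m hm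
    rw [(Oloid.mem_edgeOfRegression_iff_eq hc m).1 hm]
    exact ⟨t, hc, Oloid.development_eq_gStar hc⟩
  · rintro ⟨t, hc, rfl⟩
    exact ⟨t, _, (Oloid.mem_edgeOfRegression_iff_eq hc _).2 rfl,
      (Oloid.development_eq_gStar hc).symm⟩
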